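/- Let $R$ be an associative ring with unit, and let all modules be right $R$-modules. For a class $\mathcal C$ of modules put $\mathcal C^{\perp}=\{M\mid \operatorname{Ext}^1_R(C,M)=0 \text{ for all } C\in\mathcal C\}$ and ${}^{\perp}\mathcal C=\{M\mid \operatorname{Ext}^1_R(M,C)=0 \text{ for all } C\in\mathcal C\}$. A pair $(\mathcal A,\mathcal B)$ of classes is a cotorsion pair if $\mathcal A={}^{\perp}\mathcal B$ and $\mathcal B=\mathcal A^{\perp}$; the cotorsion pair generated by $\mathcal C$ is $({}^{\perp}(\mathcal C^{\perp}),\mathcal C^{\perp})$. A pair $(\mathcal X,\mathcal Y)$ of classes is a torsion pair if $\mathcal X=\{M\mid \operatorname{Hom}_R(M,Y)=0 \text{ for all } Y\in\mathcal Y\}$ and $\mathcal Y=\{N\mid \operatorname{Hom}_R(X,N)=0 \text{ for all } X\in\mathcal X\}$. A module $U$ is $1$-cotilting if $\operatorname{Ext}^i_R(U^{\alpha},U)=0$ for all $i>0$ and all cardinals $\alpha$, $U$ has injective dimension at most $1$, and there is an exact sequence $0\to U_1\to U_0\to W\to 0$ in which $W$ is an injective cogenerator and $U_0,U_1$ are direct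 summands of direct products of copies of $U$. A cotilting torsion pair is a torsion pair $(\mathcal X,\mathcal Y)$ such that $\mathcal Y=\{M\mid \operatorname{Ext}^i_R(M,U)=0 \text{ for all } i>0\}$ for some $1$-cotilting module $U$. Let $(\mathcal X,\mathcal Y)$ be a cotilting torsion pair which satisfies the Reiten–Ringel condition: if $Y\in\mathcal Y$ has a finitely generated submodule $0\neq Y_0\leq Y$ such that $Y/Y_0\in\mathcal X$, then $Y$ is finitely generated. Let $\mathcal Y_0$ be the class of finitely generated modules in $\mathcal Y$. Then $\mathcal Y^{\perp}=\mathcal Y_0^{\perp}$. That is, the cotorsion pair $\mathfrak Y=(\mathcal Y,\mathcal Y^{\perp})$ coincides with the cotorsion pair $\mathfrak Y_0=({}^{\perp}(\mathcal Y_0^{\perp}),\mathcal Y_0^{\perp})$ generated by $\mathcal Y_0$. -/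

import Mathlib

open CategoryTheory

universe u

namespace CotiltingTheory

variable {R : Type u} [Ring R]

/-! Modules are objects of `ModuleCat.{u} R` for a ring `R : Type u`. Right modules over a ring `A`
are the objects of `ModuleCat.{u} Aᵐᵒᵖ`. Classes of modules are predicates on the objects. -/

/-- The class of all `M` with `Ext¹(C, M) = 0` for all `C` in the class `𝒞`. -/
def rightPerp (𝒞 : ObjectProperty (ModuleCat.{u} R)) : ObjectProperty (ModuleCat.{u} R) :=
  fun M => ∀ C : ModuleCat.{u} R, 𝒞 C → Subsingleton (Abelian.Ext C M 1)

/-- The class of all `M` with `Ext¹(M, C) = 0` for all `C` in the class `𝒞`. -/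
def leftPerp (𝒞 : ObjectProperty (ModuleCat.{u} R)) : ObjectProperty (ModuleCat.{u} R) :=
  fun M => ∀ C : ModuleCat.{u} R, 𝒞 C → Subsingleton (Abelian.Ext M C 1)

/-- The class of all `M` with `Extⁿ(M, U) = 0` for all `n > 0`. -/
def leftPerpInf (U : ModuleCat.{u} R) : ObjectProperty (ModuleCat.{u} R) :=
  fun M => ∀ n : ℕ, 0 < n → Subsingleton (Abelian.Ext M U n)

/-- `Prod U`: the direct summands of direct products of copies of `U`. -/
def prodClass (U : ModuleCat.{u} R) : ObjectProperty (ModuleCat.{u} R) :=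
  fun M => ∃ ι : Type u, Nonempty (Retract M (ModuleCat.of R (ι → U)))

/-- `U` is a `1`-cotilting module. -/
structure IsOneCotilting (U : ModuleCat.{u} R) : Prop where
  ext_eq_zero : ∀ (ι : Type u) (n : ℕ), 0 < n →
    Subsingleton (Abelian.Ext (ModuleCat.of R (ι → U)) U n)
  injectiveDimension_le_one : HasInjectiveDimensionLE U 1
  /-- There is an exact sequence `0 → U₁ → U₀ → W → 0` with `U₁`, `U₀` in `Prod U` and `W` an
  injective cogenerator. -/
  exists_coresolution : ∃ T : ShortComplex (ModuleCat.{u} R), T.ShortExact ∧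
    prodClass U T.X₁ ∧ prodClass U T.X₂ ∧ Injective T.X₃ ∧ IsCoseparator T.X₃

/-- `(𝒳, 𝒴)` is a torsion pair: each class consists exactly of the modules which are
`Hom`-orthogonal to the other class. -/
structure IsTorsionPair (𝒳 𝒴 : ObjectProperty (ModuleCat.{u} R)) : Prop where
  torsion_iff : ∀ M : ModuleCat.{u} R,
    𝒳 M ↔ ∀ N : ModuleCat.{u} R, 𝒴 N → ∀ f : M ⟶ N, f = 0
  torsionFree_iff : ∀ N : ModuleCat.{u} R,
    𝒴 N ↔ ∀ M : ModuleCat.{u} R, 𝒳 M → ∀ f : M ⟶ N, f = 0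

/-- `(𝒳, 𝒴)` is a cotilting torsion pair: a torsion pair whose torsion-free class is the class of
all `M` with `Extⁿ(M, U) = 0` for all `n > 0`, for some `1`-cotilting module `U`. -/
def IsCotiltingTorsionPair (𝒳 𝒴 : ObjectProperty (ModuleCat.{u} R)) : Prop :=
  IsTorsionPair 𝒳 𝒴 ∧ ∃ U : ModuleCat.{u} R, IsOneCotilting U ∧ 𝒴 = leftPerpInf U

/-- The Reiten-Ringel condition: if `Y` in `𝒴` has a nonzero finitely generated submodule `Y₀` with
`Y / Y₀` in `𝒳`, then `Y` is finitely generated. -/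
def ReitenRingelCondition (𝒳 𝒴 : ObjectProperty (ModuleCat.{u} R)) : Prop :=
  ∀ Y : ModuleCat.{u} R, 𝒴 Y → ∀ Y₀ : Submodule R Y, Y₀ ≠ ⊥ → Y₀.FG →
    𝒳 (ModuleCat.of R (Y ⧸ Y₀)) → Module.Finite R Y

/-- `𝒜₀`: the finitely generated modules in the class `𝒜`. -/
def finitelyGeneratedPart (𝒜 : ObjectProperty (ModuleCat.{u} R)) :
    ObjectProperty (ModuleCat.{u} R) :=
  fun M => 𝒜 M ∧ Module.Finite R M

/-- `(𝒜, ℬ)` is a cotorsion pair. -/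
def IsCotorsionPair (𝒜 ℬ : ObjectProperty (ModuleCat.{u} R)) : Prop :=
  𝒜 = leftPerp ℬ ∧ ℬ = rightPerp 𝒜

/-- The cotorsion pair generated by the class `𝒞`. -/
def cotorsionPairGeneratedBy (𝒞 : ObjectProperty (ModuleCat.{u} R)) :
    ObjectProperty (ModuleCat.{u} R) × ObjectProperty (ModuleCat.{u} R) :=
  (leftPerp (rightPerp 𝒞), rightPerp 𝒞)

end CotiltingTheory

/-! Let `M` be `Ext`-orthogonal to the finitely generated modules in `𝒴`, and write `C` in `𝒴` as `E
/ P` with `E` projective. Then `Ext¹(C, M) = 0` once every map `P → M` extends to `E`. Zorn's lemma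
gives a maximal extension among those whose domain `D` has `E / D` in `𝒴`. If `D ≠ E`, the torsion
closure `N` of a nonzero cyclic submodule of `E / D` is finitely generated by the Reiten-Ringel
condition, so `Ext¹(N, M) = 0` and the map extends further (`exists_lt_of_reitenRingelCondition`).

Zorn's lemma needs `E / ⋃ Nᵢ` in `𝒴` for chains (`torsionFree_quotient_sSup`). This quotient embeds
in the product of the `E / Nᵢ` modulo eventually zero elements. That reduced product lies in `𝒴` by
a counting argument (`exists_extension_eventuallyZero`): a map to `U` that does not extend would
give, for the set `B` of branches of a suitable tree, an injection `Set B → B`. -/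

namespace CotiltingTheory

/-! ### `Ext¹` and extension of maps. -/

section Extension

variable {R : Type u} [Ring R] {A B C U : Type u} [AddCommGroup A] [AddCommGroup B]
  [AddCommGroup C] [AddCommGroup U] [Module R A] [Module R B] [Module R C] [Module R U]
  {f : A →ₗ[R] B} {g : B →ₗ[R] C}

/-- A short exact sequence of modules, given by linear maps. -/
theorem shortExact_of_linearMap (hf : Function.Injective f) (hg : Function.Surjective g)
    (hfg : Function.Exact f g) :
    (ModuleCat.shortComplexOfCompEqZero f g hfg.linearMap_comp_eq_zero).ShortExact :=
  ModuleCat.shortComplex_shortExact _ hfg hf hg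

/-- If `Ext¹(C, U) = 0`, then every map `A → U` extends along `0 → A → B → C → 0`. -/
theorem exists_extension_of_ext_one (hf : Function.Injective f) (hg : Function.Surjective g)
    (hfg : Function.Exact f g)
    (hC : Subsingleton (Abelian.Ext (ModuleCat.of R C) (ModuleCat.of R U) 1)) (h : A →ₗ[R] U) :
    ∃ H : B →ₗ[R] U, H ∘ₗ f = h := by
  have hS := shortExact_of_linearMap hf hg hfg
  obtain ⟨x, hx⟩ := Abelian.Ext.contravariant_sequence_exact₁ hS (ModuleCat.of R U)
    (Abelian.Ext.mk₀ (ModuleCat.ofHom h)) (n₁ := 1) rfl (@Subsingleton.elim _ hC _ _)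
  obtain ⟨H, rfl⟩ := (Abelian.Ext.mk₀_bijective _ _).2 x
  rw [Abelian.Ext.mk₀_comp_mk₀] at hx
  have := (Abelian.Ext.mk₀_bijective _ _).1 hx
  exact ⟨H.hom, by simpa using congrArg ModuleCat.Hom.hom this⟩

/-- If `Ext¹(B, U) = 0` and every map `A → U` extends along `0 → A → B → C → 0`, then
`Ext¹(C, U) = 0`. -/
theorem ext_one_of_exists_extension (hf : Function.Injective f) (hg : Function.Surjective g)
    (hfg : Function.Exact f g)
    (hB : Subsingleton (Abelian.Ext (ModuleCat.of R B) (ModuleCat.of R U) 1))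
    (h : ∀ h : A →ₗ[R] U, ∃ H : B →ₗ[R] U, H ∘ₗ f = h) :
    Subsingleton (Abelian.Ext (ModuleCat.of R C) (ModuleCat.of R U) 1) := by
  have hS := shortExact_of_linearMap hf hg hfg
  refine subsingleton_of_forall_eq 0 fun x => ?_
  obtain ⟨y, rfl⟩ := Abelian.Ext.contravariant_sequence_exact₃ hS (ModuleCat.of R U) x
    (@Subsingleton.elim _ hB _ _) (n₀ := 0) rfl
  obtain ⟨k, rfl⟩ := (Abelian.Ext.mk₀_bijective _ _).2 y
  obtain ⟨H, hH⟩ := h k.hom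
  have hk : k = (ModuleCat.shortComplexOfCompEqZero f g hfg.linearMap_comp_eq_zero).f ≫
      ModuleCat.ofHom H := by
    ext x
    exact (LinearMap.congr_fun hH x).symm
  rw [hk, ← Abelian.Ext.mk₀_comp_mk₀, ShortComplex.ShortExact.extClass_comp_assoc]

/-- If `Ext¹` of the range of `φ : B → C` with `U` vanishes, then every map `A → U` agrees with a map
`B → U` on the kernel of `φ`, provided that the injection `f : A → B` contains this kernel in its
range. -/
theorem exists_extension_on_ker (f : A →ₗ[R] B) (hf : Function.Injective f) (φ : B →ₗ[R] C)
    (hker : ∀ b, φ b = 0 → ∃ a, f a = b)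
    (hU : Subsingleton (Abelian.Ext (ModuleCat.of R (LinearMap.range φ)) (ModuleCat.of R U) 1))
    (h : A →ₗ[R] U) : ∃ H : B →ₗ[R] U, ∀ a, φ (f a) = 0 → H (f a) = h a := by
  let K := LinearMap.ker (φ ∘ₗ f)
  have hexact : Function.Exact (f ∘ₗ K.subtype) φ.rangeRestrict := by
    intro b
    constructor
    · intro hb
      replace hb : φ b = 0 := congrArg Subtype.val hb
      obtain ⟨a, rfl⟩ := hker b hb
      exact ⟨⟨a, hb⟩, rfl⟩
    · rintro ⟨a, rfl⟩
      exact Subtype.ext a.2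
  obtain ⟨H, hH⟩ := exists_extension_of_ext_one (f := f ∘ₗ K.subtype)
    (hf.comp K.injective_subtype) φ.surjective_rangeRestrict hexact hU (h ∘ₗ K.subtype)
  exact ⟨H, fun a ha => LinearMap.congr_fun hH ⟨a, ha⟩⟩

end Extension

/-! ### Many maps from one non-extendable map. -/

section Counting

variable {R : Type u} [Ring R] {B P G U : Type u} [AddCommGroup P] [AddCommGroup G]
  [AddCommGroup U] [Module R P] [Module R G] [Module R U] {Q : Submodule R P}

open Classical in
/-- If some map `Q → U` does not extend to `P`, then the maps from a direct sum of copies of `Q`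
to `U` which vanish on a suitable submodule are at least as many as the sets of summands. -/
theorem exists_injective_of_not_exists_extension (φ : (B →₀ P) →ₗ[R] G)
    (hφ : ∀ x, φ x = 0 → ∀ b, x b ∈ Q)
    (hU : Subsingleton (Abelian.Ext (ModuleCat.of R (LinearMap.range φ)) (ModuleCat.of R U) 1))
    (h : Q →ₗ[R] U) (hno : ¬ ∃ H : P →ₗ[R] U, H ∘ₗ Q.subtype = h) :
    ∃ d : Set B → ((B →₀ Q) →ₗ[R] U), Function.Injective d ∧
      ∀ A x, φ (Finsupp.mapRange.linearMap Q.subtype x) = 0 → d A x = 0 := by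
  let ι : (B →₀ Q) →ₗ[R] (B →₀ P) := Finsupp.mapRange.linearMap Q.subtype
  have hι : Function.Injective ι := Finsupp.mapRange_injective _ rfl Q.injective_subtype
  have hker (x : B →₀ P) (hx : φ x = 0) : ∃ y, ι y = x := by
    refine ⟨Finsupp.onFinset x.support (fun b => ⟨x b, hφ x hx b⟩) fun b hb => by
      simpa [Subtype.ext_iff] using hb, ?_⟩
    ext1 b
    simp [ι]
  let hA (A : Set B) : (B →₀ Q) →ₗ[R] U := Finsupp.lsum ℕ fun b => if b ∈ A then h else 0
  choose H hH using fun A => exists_extension_on_ker ι hι φ hker hU (hA A)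
  have hsub (A A' : Set B) (hAA : hA A - H A ∘ₗ ι = hA A' - H A' ∘ₗ ι) : A ⊆ A' := by
    intro b hb
    by_contra hb'
    -- On the summand at `b`, `hA A - hA A'` is `h`, so `H A - H A'` would extend `h`.
    refine hno ⟨(H A - H A') ∘ₗ Finsupp.lsingle b, ?_⟩
    ext q
    have := LinearMap.congr_fun hAA (Finsupp.single b q)
    simp only [hA, LinearMap.sub_apply, Finsupp.lsum_single, if_pos hb, if_neg hb', ι,
      LinearMap.comp_apply, Finsupp.mapRange.linearMap_apply, Finsupp.mapRange_single,
      LinearMap.zero_apply, zero_sub] at this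
    simp only [LinearMap.comp_apply, LinearMap.sub_apply, Finsupp.lsingle_apply]
    rw [sub_eq_iff_eq_add] at this
    rw [this]
    abel
  refine ⟨fun A => hA A - H A ∘ₗ ι, fun A A' hAA => (hsub A A' hAA).antisymm (hsub A' A hAA.symm),
    fun A x hx => ?_⟩
  rw [LinearMap.sub_apply, LinearMap.comp_apply, hH A x hx, sub_self]

end Counting

/-! ### A tree with a prescribed number of branches. -/

section Tree

/-- The part of a branch below an index. -/
abbrev branchBelow {I : Type u} [LinearOrder I] {D : I → Type u} (b : ∀ i, D i) (i : I) :
    ∀ j : Set.Iio i, D j :=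
  fun j => b j.1

/-- The successor sets of a tree of height `I` which has as many branches as there are sets of
pairs of a node and an element of `Q`. -/
theorem exists_tree (I Q : Type u) [LinearOrder I] [WellFoundedLT I] :
    ∃ D : I → Type u, (∀ i, Nonempty (D i)) ∧
      Nonempty ((∀ i, D i) ≃ Set (Σ i : I, (∀ j : Set.Iio i, D j.1) × Q)) := by
  -- The successor set at level `i` is the power set of (nodes at level `i`) `× Q`. A product of
  -- power sets is the power set of the disjoint union, so no cardinal arithmetic is needed.
  let D : I → Type u := wellFounded_lt.fix
    (fun i D => Set ((∀ j : Set.Iio i, D j.1 j.2) × Q))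
  have hD : ∀ i : I, D i = Set ((∀ j : Set.Iio i, D j.1) × Q) := fun i => wellFounded_lt.fix_eq _ i
  exact ⟨D, fun i => ⟨cast (hD i).symm ∅⟩,
    ⟨(Equiv.piCongrRight fun i => Equiv.cast (hD i)).trans (Equiv.piCurry _).symm⟩⟩

end Tree

/-! ### Products modulo eventually zero elements. -/

section ReducedProduct

variable {R : Type u} [Ring R] {I : Type u} [LinearOrder I] (Z : I → Type u)
  [∀ i, AddCommGroup (Z i)] [∀ i, Module R (Z i)]

/-- The elements of a product which vanish eventually. -/
def eventuallyZero (R : Type u) [Ring R] {I : Type u} [LinearOrder I] (Z : I → Type u)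
    [∀ i, AddCommGroup (Z i)] [∀ i, Module R (Z i)] : Submodule R (∀ i, Z i) where
  carrier := {p | ∀ᶠ i in Filter.atTop, p i = 0}
  add_mem' := fun ha hb => by
    filter_upwards [ha, hb] with i h₁ h₂
    simp [h₁, h₂]
  zero_mem' := by simp
  smul_mem' := fun c x hx => by
    filter_upwards [show ∀ᶠ i in Filter.atTop, x i = 0 from hx] with i h
    simp [h]

theorem mem_eventuallyZero {p : ∀ i, Z i} :
    p ∈ eventuallyZero R Z ↔ ∀ᶠ i in Filter.atTop, p i = 0 := Iff.rfl

/-- The truncation of an element of a product below an index. -/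
def truncate [NoMaxOrder I] (i : I) (p : ∀ i, Z i) : eventuallyZero R Z :=
  ⟨fun j => if j < i then p j else 0, by
    have : Nonempty I := ⟨i⟩
    filter_upwards [Filter.eventually_ge_atTop i] with j hj
    simp [not_lt.2 hj]⟩

open Classical in
/-- The embedding of a product into a product over the nodes of a tree, along a branch. -/
noncomputable def alongBranch (R : Type u) [Ring R] {I : Type u} [LinearOrder I] (Z : I → Type u)
    [∀ i, AddCommGroup (Z i)] [∀ i, Module R (Z i)] {D : I → Type u} (b : ∀ i, D i) :
    (∀ i, Z i) →ₗ[R] (∀ t : Σ i, (∀ j : Set.Iio i, D j), Z t.1) :=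
  LinearMap.pi fun t => if t.2 = branchBelow b t.1 then LinearMap.proj t.1 else 0

/-- The restriction of an element of a product over the nodes of a tree to a branch. -/
def restrictBranch (R : Type u) [Ring R] {I : Type u} [LinearOrder I] (Z : I → Type u)
    [∀ i, AddCommGroup (Z i)] [∀ i, Module R (Z i)] {D : I → Type u} (b : ∀ i, D i) :
    (∀ t : Σ i, (∀ j : Set.Iio i, D j), Z t.1) →ₗ[R] (∀ i, Z i) :=
  LinearMap.pi fun i => LinearMap.proj (⟨i, branchBelow b i⟩ : Σ i, (∀ j : Set.Iio i, D j))

variable {D : I → Type u}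

theorem restrictBranch_alongBranch (b : ∀ i, D i) (p : ∀ i, Z i) :
    restrictBranch R Z b (alongBranch R Z b p) = p := by
  ext i
  simp [restrictBranch, alongBranch]

/-- Branches that differ at `i` have different nodes at every level beyond `i`. -/
theorem restrictBranch_alongBranch_of_ne [NoMaxOrder I] {b c : ∀ i, D i} (h : b ≠ c)
    (p : ∀ i, Z i) : restrictBranch R Z c (alongBranch R Z b p) ∈ eventuallyZero R Z := by
  obtain ⟨i, hi⟩ := Function.ne_iff.1 h
  have : Nonempty I := ⟨i⟩
  filter_upwards [Filter.eventually_gt_atTop i] with j hj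
  have : branchBelow c j ≠ branchBelow b j := fun h' => hi (congrFun h' ⟨i, hj⟩).symm
  simp [restrictBranch, alongBranch, this]

-- Only nodes at levels `j < i` carry nonzero entries, and these see the branch only below `j`.
open Classical in
theorem alongBranch_congr {b c : ∀ i, D i} {p : ∀ i, Z i} {i : I} (hp : ∀ j, i ≤ j → p j = 0)
    (h : ∀ j < i, b j = c j) : alongBranch R Z b p = alongBranch R Z c p := by
  ext ⟨j, n⟩
  rcases le_or_gt i j with hj | hj
  · simp only [alongBranch, LinearMap.pi_apply]
    split_ifs <;> simp [hp j hj]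
  · have : branchBelow b j = branchBelow c j :=
      funext fun k => h k (lt_trans k.2 hj)
    simp [alongBranch, this]

/-- If a sum of elements along finitely many branches is zero, then each summand vanishes
eventually. -/
theorem mem_eventuallyZero_of_lsum_alongBranch [NoMaxOrder I] (x : (∀ i, D i) →₀ (∀ i, Z i))
    (hx : Finsupp.lsum ℕ (alongBranch R Z (D := D)) x = 0) (b : ∀ i, D i) :
    x b ∈ eventuallyZero R Z := by
  classical
  -- Modulo eventually zero elements, restriction to `b` erases the contributions of all other
  -- branches.
  have key : (eventuallyZero R Z).mkQ ∘ₗ restrictBranch R Z b ∘ₗ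
      Finsupp.lsum ℕ (alongBranch R Z (D := D)) =
      (eventuallyZero R Z).mkQ ∘ₗ Finsupp.lapply b := by
    refine Finsupp.lhom_ext fun c p => ?_
    by_cases h : c = b
    · subst h
      simp [restrictBranch_alongBranch]
    · simpa [Finsupp.single_eq_of_ne (Ne.symm h)] using
        restrictBranch_alongBranch_of_ne Z h p
  have := LinearMap.congr_fun key x
  rw [← Submodule.Quotient.mk_eq_zero]
  simpa only [LinearMap.comp_apply, hx, map_zero, Finsupp.lapply_apply, Submodule.mkQ_apply]
    using this.symm

variable {Z}

-- The maps `d A` vanish on the relations between branches. Hence the value at `q`, placed on a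
-- branch, depends only on `q` and on the node at a level from which `q` vanishes. So `d A` is coded
-- by a set of triples (node, element, value), and the tree has exactly as many branches as there
-- are such sets, against Cantor.
open Classical in
theorem exists_extension_eventuallyZero [WellFoundedLT I] [NoMaxOrder I] [Nonempty I]
    {U : Type u} [AddCommGroup U] [Module R U]
    (hU : ∀ (T : Type u) (σ : T → I) (S : Submodule R (∀ t, Z (σ t))),
      Subsingleton (Abelian.Ext (ModuleCat.of R S) (ModuleCat.of R U) 1))
    (h : eventuallyZero R Z →ₗ[R] U) :
    ∃ H : (∀ i, Z i) →ₗ[R] U, H ∘ₗ (eventuallyZero R Z).subtype = h := by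
  by_contra hno
  obtain ⟨D, hD, ⟨e⟩⟩ := exists_tree I ((∀ i, Z i) × U)
  obtain ⟨d, hinj, hd⟩ := exists_injective_of_not_exists_extension
    (Finsupp.lsum ℕ (alongBranch R Z (D := D))) (mem_eventuallyZero_of_lsum_alongBranch Z)
    (hU (Σ i, (∀ j : Set.Iio i, D j)) (fun t => t.1) _) h hno
  -- An arbitrary branch through the node `n`; by `hb` below the choice is harmless.
  let ext (i : I) (n : ∀ j : Set.Iio i, D j) : ∀ j, D j :=
    fun j => if hj : j < i then n ⟨j, hj⟩ else Classical.choice (hD j)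
  let code (A : Set (∀ i, D i)) : Set (Σ i : I, (∀ j : Set.Iio i, D j.1) × ((∀ i, Z i) × U)) :=
    {s | d A (Finsupp.single (ext s.1 s.2.1) (truncate Z s.1 s.2.2.1)) = s.2.2.2}
  have hcode : Function.Injective code := by
    intro A A' hAA
    refine hinj (Finsupp.lhom_ext fun b q => ?_)
    obtain ⟨i, hi⟩ := Filter.eventually_atTop.1 ((mem_eventuallyZero Z).1 q.2)
    have hq : truncate Z i q.1 = q := by
      ext j
      rcases lt_or_ge j i with hj | hj
      · simp [truncate, hj]
      · simp [truncate, not_lt.2 hj, hi j hj]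
    have hb (A : Set (∀ i, D i)) : d A (Finsupp.single b q) =
        d A (Finsupp.single (ext i (branchBelow b i)) q) := by
      rw [← sub_eq_zero, ← map_sub]
      refine hd A _ ?_
      rw [map_sub, map_sub, sub_eq_zero, Finsupp.mapRange.linearMap_apply,
        Finsupp.mapRange.linearMap_apply, Finsupp.mapRange_single, Finsupp.mapRange_single,
        Finsupp.lsum_single, Finsupp.lsum_single]
      exact alongBranch_congr Z hi fun j hj => by simp [ext, hj]
    have := Set.ext_iff.1 hAA ⟨i, branchBelow b i, q.1,
      d A' (Finsupp.single (ext i (branchBelow b i)) q)⟩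
    simp only [code, Set.mem_ofPred_eq, hq, iff_true] at this
    rw [hb, hb, this]
  exact Function.cantor_injective (fun A => e.symm (code A)) (e.symm.injective.comp hcode)

end ReducedProduct

/-! ### Closure properties and torsion submodules. -/

section TorsionPair

variable {R : Type u} [Ring R] {𝒳 𝒴 : ObjectProperty (ModuleCat.{u} R)}

namespace IsTorsionPair

theorem torsion_of_forall (h : IsTorsionPair 𝒳 𝒴) {M : Type u} [AddCommGroup M] [Module R M]
    (hM : ∀ N : ModuleCat.{u} R, 𝒴 N → ∀ f : M →ₗ[R] N, f = 0) : 𝒳 (ModuleCat.of R M) :=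
  (h.torsion_iff _).2 fun N hN f => ModuleCat.hom_ext (hM N hN f.hom)

theorem torsionFree_of_forall (h : IsTorsionPair 𝒳 𝒴) {N : Type u} [AddCommGroup N] [Module R N]
    (hN : ∀ M : ModuleCat.{u} R, 𝒳 M → ∀ f : M →ₗ[R] N, f = 0) : 𝒴 (ModuleCat.of R N) :=
  (h.torsionFree_iff _).2 fun M hM f => ModuleCat.hom_ext (hN M hM f.hom)

theorem hom_eq_zero (h : IsTorsionPair 𝒳 𝒴) {M N : Type u} [AddCommGroup M] [Module R M]
    [AddCommGroup N] [Module R N] (hM : 𝒳 (ModuleCat.of R M)) (hN : 𝒴 (ModuleCat.of R N))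
    (f : M →ₗ[R] N) : f = 0 :=
  congrArg ModuleCat.Hom.hom ((h.torsion_iff _).1 hM _ hN (ModuleCat.ofHom f))

theorem torsion_of_surjective (h : IsTorsionPair 𝒳 𝒴) {M N : Type u} [AddCommGroup M] [Module R M]
    [AddCommGroup N] [Module R N] (hM : 𝒳 (ModuleCat.of R M)) (f : M →ₗ[R] N)
    (hf : Function.Surjective f) : 𝒳 (ModuleCat.of R N) :=
  h.torsion_of_forall fun _ hL g =>
    (LinearMap.cancel_right hf).1 (by rw [h.hom_eq_zero hM hL (g ∘ₗ f), LinearMap.zero_comp])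

theorem torsionFree_of_injective (h : IsTorsionPair 𝒳 𝒴) {M N : Type u} [AddCommGroup M]
    [Module R M] [AddCommGroup N] [Module R N] (hN : 𝒴 (ModuleCat.of R N)) (f : M →ₗ[R] N)
    (hf : Function.Injective f) : 𝒴 (ModuleCat.of R M) :=
  h.torsionFree_of_forall fun _ hL g =>
    (LinearMap.cancel_left hf).1 (by rw [h.hom_eq_zero hL hN (f ∘ₗ g), LinearMap.comp_zero])

theorem torsionFree_pi (h : IsTorsionPair 𝒳 𝒴) {ι : Type u} {N : ι → Type u}
    [∀ i, AddCommGroup (N i)] [∀ i, Module R (N i)] (hN : ∀ i, 𝒴 (ModuleCat.of R (N i))) :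
    𝒴 (ModuleCat.of R (∀ i, N i)) :=
  h.torsionFree_of_forall fun _ hL g => by
    ext x i
    exact LinearMap.congr_fun (h.hom_eq_zero hL (hN i) (LinearMap.proj i ∘ₗ g)) x

/-- Every module is an extension of a torsion-free module by a torsion module. -/
theorem exists_torsion_submodule (h : IsTorsionPair 𝒳 𝒴) (W : Type u) [AddCommGroup W]
    [Module R W] :
    ∃ T : Submodule R W, 𝒳 (ModuleCat.of R T) ∧ 𝒴 (ModuleCat.of R (W ⧸ T)) := by
  let T : Submodule R W := sSup {N | 𝒳 (ModuleCat.of R N)}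
  have hT : 𝒳 (ModuleCat.of R T) := by
    refine h.torsion_of_forall fun Y hY f => ?_
    have hle : T ≤ (LinearMap.ker f).map T.subtype := sSup_le fun N hN x hx => by
      have hNT : N ≤ T := le_sSup hN
      exact ⟨⟨x, hNT hx⟩, LinearMap.congr_fun
        (h.hom_eq_zero hN hY (f ∘ₗ Submodule.inclusion hNT)) ⟨x, hx⟩, rfl⟩
    ext x
    obtain ⟨y, hy, hyx⟩ := hle x.2
    rwa [← Subtype.ext hyx]
  refine ⟨T, hT, h.torsionFree_of_forall fun X hX f => ?_⟩
  -- `N` is an extension of a torsion quotient of `X` by `T`, hence torsion, so `N ≤ T` and `f = 0`.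
  let N : Submodule R W := (LinearMap.range f).comap T.mkQ
  have hTN : T ≤ N := fun x hx => by
    simp [N, (Submodule.Quotient.mk_eq_zero T).2 hx]
  have hN : 𝒳 (ModuleCat.of R N) := by
    refine h.torsion_of_forall fun Y hY g => ?_
    have hg : ∀ x (hx : x ∈ T), g ⟨x, hTN hx⟩ = 0 := fun x hx =>
      LinearMap.congr_fun (h.hom_eq_zero hT hY (g ∘ₗ Submodule.inclusion hTN)) ⟨x, hx⟩
    let π : N →ₗ[R] LinearMap.range f := (T.mkQ ∘ₗ N.subtype).codRestrict _ fun x => x.2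
    have hπ : Function.Surjective π := by
      rintro ⟨y, hy⟩
      obtain ⟨x, rfl⟩ := T.mkQ_surjective y
      exact ⟨⟨x, hy⟩, rfl⟩
    have hker : LinearMap.ker π ≤ LinearMap.ker g := fun x hx =>
      hg x.1 ((Submodule.Quotient.mk_eq_zero T).1 (congrArg Subtype.val hx))
    let k := (LinearMap.ker π).liftQ g hker ∘ₗ (π.quotKerEquivOfSurjective hπ).symm.toLinearMap
    have hk : k = 0 := h.hom_eq_zero
      (h.torsion_of_surjective hX f.rangeRestrict f.surjective_rangeRestrict) hY k
    ext x
    have : k (π x) = g x := by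
      have : (π.quotKerEquivOfSurjective hπ).symm (π x) = Submodule.Quotient.mk x := by
        rw [LinearEquiv.symm_apply_eq]
        rfl
      simp [k, this]
    rw [← this, hk]
    rfl
  have hNT : N ≤ T := le_sSup hN
  ext x
  obtain ⟨w, hw⟩ := T.mkQ_surjective (f x)
  have : w ∈ T := hNT (show T.mkQ w ∈ LinearMap.range f from hw ▸ ⟨x, rfl⟩)
  rw [← hw]
  exact (Submodule.Quotient.mk_eq_zero T).2 this

/-- Every submodule `L` of `W` is contained in a submodule `N` such that `N / L` is torsion and
`W / N` is torsion-free. -/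
theorem exists_torsion_closure (h : IsTorsionPair 𝒳 𝒴) {W : Type u} [AddCommGroup W]
    [Module R W] (L : Submodule R W) :
    ∃ N : Submodule R W, L ≤ N ∧ 𝒳 (ModuleCat.of R (N ⧸ L.submoduleOf N)) ∧
      𝒴 (ModuleCat.of R (W ⧸ N)) := by
  obtain ⟨T, hT, hWT⟩ := h.exists_torsion_submodule (W ⧸ L)
  let N := T.comap L.mkQ
  refine ⟨N, fun x hx => ?_, ?_, ?_⟩
  · simp [N, (Submodule.Quotient.mk_eq_zero L).2 hx]
  · let π : N →ₗ[R] T := (L.mkQ ∘ₗ N.subtype).codRestrict _ fun x => x.2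
    have hπ : Function.Surjective π := by
      rintro ⟨y, hy⟩
      obtain ⟨x, rfl⟩ := L.mkQ_surjective y
      exact ⟨⟨x, hy⟩, rfl⟩
    have hker : LinearMap.ker π = L.submoduleOf N := by
      ext x
      rw [LinearMap.mem_ker, Subtype.ext_iff]
      exact Submodule.Quotient.mk_eq_zero L
    rw [← hker]
    exact h.torsion_of_surjective hT (π.quotKerEquivOfSurjective hπ).symm.toLinearMap
      (LinearEquiv.surjective _)
  · refine h.torsionFree_of_injective hWT (N.liftQ (T.mkQ ∘ₗ L.mkQ) ?_) ?_
    · exact (by rw [LinearMap.ker_comp, Submodule.ker_mkQ] : N = _).le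
    · rw [← LinearMap.ker_eq_bot]
      exact Submodule.ker_liftQ_eq_bot _ _ _ (by rw [LinearMap.ker_comp, Submodule.ker_mkQ])

end IsTorsionPair

end TorsionPair

/-! ### Quotients by unions of chains. -/

section DirectLimit

variable {R : Type u} [Ring R] {𝒳 𝒴 : ObjectProperty (ModuleCat.{u} R)} {U : ModuleCat.{u} R}

/-- Injective dimension at most 1 kills the higher groups; the cotilting module enters the proof in
this form. -/
theorem leftPerpInf_iff (hU : HasInjectiveDimensionLE U 1) (M : ModuleCat.{u} R) :
    leftPerpInf U M ↔ Subsingleton (Abelian.Ext M U 1) := by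
  refine ⟨fun h => h 1 one_pos, fun h n hn => ?_⟩
  obtain rfl | hn := Nat.eq_or_lt_of_le hn
  · exact h
  · exact HasInjectiveDimensionLT.subsingleton U 2 n hn M

/-- A torsion-free class of the form `{M | Ext¹(M, U) = 0}` is closed under products, indexed by a
well-order, modulo the submodule of the elements which vanish eventually. -/
theorem torsionFree_reducedProduct (h : IsTorsionPair 𝒳 𝒴)
    (hU : ∀ M, 𝒴 M ↔ Subsingleton (Abelian.Ext M U 1)) {I : Type u} [LinearOrder I]
    [WellFoundedLT I] [NoMaxOrder I] [Nonempty I] {Z : I → Type u} [∀ i, AddCommGroup (Z i)]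
    [∀ i, Module R (Z i)] (hZ : ∀ i, 𝒴 (ModuleCat.of R (Z i))) :
    𝒴 (ModuleCat.of R ((∀ i, Z i) ⧸ eventuallyZero R Z)) := by
  refine (hU _).2 (ext_one_of_exists_extension (eventuallyZero R Z).injective_subtype
    (eventuallyZero R Z).mkQ_surjective
    (LinearMap.exact_subtype_mkQ _) ((hU _).1 (h.torsionFree_pi hZ)) ?_)
  exact exists_extension_eventuallyZero fun T σ S => (hU _).1
    (h.torsionFree_of_injective (h.torsionFree_pi fun t => hZ (σ t)) S.subtype S.injective_subtype)

/-- The diagonal map into the reduced product has kernel `⨆ i, N i`: by monotonicity, lying in some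
`N i` means lying in all later ones. -/
theorem torsionFree_quotient_iSup (h : IsTorsionPair 𝒳 𝒴)
    (hU : ∀ M, 𝒴 M ↔ Subsingleton (Abelian.Ext M U 1)) {I : Type u} [LinearOrder I]
    [WellFoundedLT I] [NoMaxOrder I] [Nonempty I] {E : Type u} [AddCommGroup E] [Module R E]
    {N : I → Submodule R E} (hN : Monotone N) (hY : ∀ i, 𝒴 (ModuleCat.of R (E ⧸ N i))) :
    𝒴 (ModuleCat.of R (E ⧸ ⨆ i, N i)) := by
  let ψ : E →ₗ[R] (∀ i, E ⧸ N i) ⧸ eventuallyZero R (fun i => E ⧸ N i) :=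
    Submodule.mkQ _ ∘ₗ LinearMap.pi fun i => (N i).mkQ
  have hker : LinearMap.ker ψ = ⨆ i, N i := by
    ext x
    rw [Submodule.mem_iSup_of_directed _ hN.directed_le, LinearMap.mem_ker]
    simp only [ψ, LinearMap.comp_apply, Submodule.mkQ_apply, Submodule.Quotient.mk_eq_zero,
      mem_eventuallyZero, LinearMap.pi_apply, Filter.eventually_atTop]
    exact ⟨fun ⟨i, hi⟩ => ⟨i, hi i le_rfl⟩, fun ⟨i, hi⟩ => ⟨i, fun j hj => hN hj hi⟩⟩
  exact h.torsionFree_of_injective (torsionFree_reducedProduct h hU hY)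
    ((⨆ i, N i).liftQ ψ hker.ge)
    (LinearMap.ker_eq_bot.1 (Submodule.ker_liftQ_eq_bot _ _ _ hker.le))

/-- If `E / N` is torsion-free for all members `N` of a chain of submodules, then also for their
union. -/
theorem torsionFree_quotient_sSup (h : IsTorsionPair 𝒳 𝒴)
    (hU : ∀ M, 𝒴 M ↔ Subsingleton (Abelian.Ext M U 1)) {E : Type u} [AddCommGroup E]
    [Module R E] {c : Set (Submodule R E)} (hc : IsChain (· ≤ ·) c) (hne : c.Nonempty)
    (hY : ∀ N ∈ c, 𝒴 (ModuleCat.of R (E ⧸ N))) : 𝒴 (ModuleCat.of R (E ⧸ sSup c)) := by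
  classical
  by_cases hmax : ∃ m ∈ c, ∀ N ∈ c, N ≤ m
  · obtain ⟨m, hm, hle⟩ := hmax
    rw [(le_antisymm (sSup_le hle) (le_sSup hm) : sSup c = m)]
    exact hY m hm
  push Not at hmax
  let _ : LinearOrder c := hc.linearOrder
  -- The members exceeding all their predecessors in a well-order of `c` form a cofinal subset, on
  -- which inclusion is itself a well-order.
  let S : Set c := {a | ∀ b, WellOrderingRel b a → b < a}
  have hS : IsCofinal S := isCofinal_setOfPred_imp_lt WellOrderingRel
  have : WellFoundedLT S := by
    refine ⟨Subrelation.wf (r := InvImage WellOrderingRel Subtype.val) (fun {a b} hab => ?_)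
      (InvImage.wf _ WellOrderingRel.isWellOrder.wf)⟩
    rcases trichotomous_of WellOrderingRel a.1 b.1 with h | h | h
    · exact h
    · exact absurd (Subtype.ext h) hab.ne
    · exact absurd (a.2 _ h) hab.not_gt
  have : Nonempty S := by
    obtain ⟨N, hN⟩ := hne
    obtain ⟨b, hb, -⟩ := hS ⟨N, hN⟩
    exact ⟨b, hb⟩
  have : NoMaxOrder S := by
    refine ⟨fun a => ?_⟩
    obtain ⟨N, hN, hNa⟩ := hmax a.1.1 a.1.2
    obtain ⟨b, hb, hNb⟩ := hS ⟨N, hN⟩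
    exact ⟨⟨b, hb⟩, lt_of_not_ge fun hba => hNa (le_trans hNb hba)⟩
  have heq : sSup c = ⨆ i : S, i.1.1 := by
    refine le_antisymm (sSup_le fun N hN => ?_) (iSup_le fun i => le_sSup i.1.2)
    obtain ⟨b, hb, hNb⟩ := hS ⟨N, hN⟩
    exact le_trans hNb (le_iSup (fun i : S => i.1.1) ⟨b, hb⟩)
  rw [heq]
  exact torsionFree_quotient_iSup h hU (fun _ _ hij => hij) fun i => hY _ i.1.2

end DirectLimit

/-! ### Extending maps by Zorn's lemma. -/

section ReitenRingel

variable {R : Type u} [Ring R] {𝒳 𝒴 : ObjectProperty (ModuleCat.{u} R)} {U : ModuleCat.{u} R}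

/-- Under the Reiten-Ringel condition, a map into `M` defined on a proper submodule with
torsion-free quotient can be extended to a larger such submodule, if `M` is `Ext`-orthogonal to the
finitely generated torsion-free modules. -/
theorem exists_lt_of_reitenRingelCondition (h : IsTorsionPair 𝒳 𝒴)
    (hRR : ReitenRingelCondition 𝒳 𝒴) {M : ModuleCat.{u} R}
    (hM : rightPerp (finitelyGeneratedPart 𝒴) M) {E : Type u} [AddCommGroup E] [Module R E]
    (f : E →ₗ.[R] M) (hf : 𝒴 (ModuleCat.of R (E ⧸ f.domain))) (hne : f.domain ≠ ⊤) :
    ∃ g : E →ₗ.[R] M, 𝒴 (ModuleCat.of R (E ⧸ g.domain)) ∧ f < g := by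
  obtain ⟨x, -, hx⟩ := SetLike.exists_of_lt hne.lt_top
  let P := f.domain
  let L : Submodule R (E ⧸ P) := Submodule.span R {P.mkQ x}
  obtain ⟨N, hLN, hX, hY⟩ := h.exists_torsion_closure L
  have hxN : P.mkQ x ∈ N := hLN (Submodule.mem_span_singleton_self _)
  have hNY : 𝒴 (ModuleCat.of R N) :=
    h.torsionFree_of_injective hf N.subtype N.injective_subtype
  have hfin : Module.Finite R N := by
    -- `L` is cyclic, and nonzero because `x` lies outside `P`.
    refine hRR (ModuleCat.of R N) hNY (L.submoduleOf N) ?_ ?_ hX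
    · intro hbot
      have : (⟨P.mkQ x, hxN⟩ : N) ∈ L.submoduleOf N := Submodule.mem_span_singleton_self (P.mkQ x)
      rw [hbot, Submodule.mem_bot] at this
      exact hx ((Submodule.Quotient.mk_eq_zero P).1 (congrArg Subtype.val this))
    · refine Submodule.fg_of_fg_map_injective N.subtype N.injective_subtype ?_
      rw [Submodule.submoduleOf, Submodule.map_comap_subtype, inf_eq_right.2 hLN]
      exact Submodule.fg_span_singleton _
  let P' := N.comap P.mkQ
  have hPP' : P ≤ P' := fun y hy => by
    simp [P', (Submodule.Quotient.mk_eq_zero P).2 hy]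
  let π : P' →ₗ[R] N := (P.mkQ ∘ₗ P'.subtype).codRestrict _ fun x => x.2
  have hπ : Function.Surjective π := by
    rintro ⟨y, hy⟩
    obtain ⟨x, rfl⟩ := P.mkQ_surjective y
    exact ⟨⟨x, hy⟩, rfl⟩
  have hexact : Function.Exact (Submodule.inclusion hPP') π := by
    intro y
    rw [Subtype.ext_iff]
    change (P.mkQ y.1 = 0) ↔ _
    rw [Submodule.mkQ_apply, Submodule.Quotient.mk_eq_zero]
    exact ⟨fun hy => ⟨⟨y, hy⟩, rfl⟩, fun ⟨z, hz⟩ => hz ▸ z.2⟩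
  obtain ⟨H, hH⟩ := exists_extension_of_ext_one (Submodule.inclusion_injective hPP') hπ hexact
    (hM _ ⟨hNY, hfin⟩) f.toFun
  refine ⟨⟨P', H⟩, ?_, lt_of_le_not_ge ⟨hPP', fun y z hyz => ?_⟩ fun hle => hx (hle.1 hxN)⟩
  · refine h.torsionFree_of_injective hY (P'.liftQ (N.mkQ ∘ₗ P.mkQ) ?_) ?_
    · exact (by rw [LinearMap.ker_comp, Submodule.ker_mkQ] : P' = _).le
    · rw [← LinearMap.ker_eq_bot]
      exact Submodule.ker_liftQ_eq_bot _ _ _ (by rw [LinearMap.ker_comp, Submodule.ker_mkQ])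
  · have := LinearMap.congr_fun hH y
    rw [LinearMap.comp_apply, (Subtype.ext hyz : Submodule.inclusion hPP' y = z)] at this
    exact this.symm

theorem exists_extension_of_reitenRingelCondition (h : IsTorsionPair 𝒳 𝒴)
    (hU : ∀ M, 𝒴 M ↔ Subsingleton (Abelian.Ext M U 1))
    (hRR : ReitenRingelCondition 𝒳 𝒴) {M : ModuleCat.{u} R}
    (hM : rightPerp (finitelyGeneratedPart 𝒴) M) {E : Type u} [AddCommGroup E] [Module R E]
    {P : Submodule R E} (hP : 𝒴 (ModuleCat.of R (E ⧸ P))) (f : P →ₗ[R] M) :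
    ∃ H : E →ₗ[R] M, H ∘ₗ P.subtype = f := by
  obtain ⟨g, hfg, hg⟩ := zorn_le_nonempty₀ {g : E →ₗ.[R] M | 𝒴 (ModuleCat.of R (E ⧸ g.domain))}
    (fun c hcY hc y hy => by
      refine ⟨LinearPMap.sSup c hc.directedOn, ?_, fun z hz => LinearPMap.le_sSup _ hz⟩
      refine torsionFree_quotient_sSup h hU ?_ ⟨_, y, hy, rfl⟩ ?_
      · rintro _ ⟨a, ha, rfl⟩ _ ⟨b, hb, rfl⟩ -
        exact (hc.total ha hb).imp (fun h => h.1) fun h => h.1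
      · rintro _ ⟨a, ha, rfl⟩
        exact hcY ha) ⟨P, f⟩ hP
  have htop : g.domain = ⊤ := by
    by_contra hne
    obtain ⟨k, hk, hlt⟩ := exists_lt_of_reitenRingelCondition h hRR hM g hg.prop hne
    exact hg.not_gt hk hlt
  refine ⟨g.toFun ∘ₗ LinearMap.codRestrict g.domain LinearMap.id fun x => htop ▸ trivial, ?_⟩
  ext x
  exact (hfg.2 rfl).symm

theorem rightPerp_finitelyGeneratedPart (h : IsTorsionPair 𝒳 𝒴)
    (hU : ∀ M, 𝒴 M ↔ Subsingleton (Abelian.Ext M U 1))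
    (hRR : ReitenRingelCondition 𝒳 𝒴) :
    rightPerp 𝒴 = rightPerp (finitelyGeneratedPart 𝒴) := by
  refine le_antisymm (fun M hM C hC => hM C hC.1) fun M hM C hC => ?_
  let π : (Projective.over C : ModuleCat.{u} R) →ₗ[R] C := (Projective.π C).hom
  have hπ : Function.Surjective π := (ModuleCat.epi_iff_surjective (Projective.π C)).1 inferInstance
  refine ext_one_of_exists_extension (C := C) (U := M)
    (f := (LinearMap.ker π).subtype) (LinearMap.ker π).injective_subtype hπ
    (LinearMap.exact_subtype_ker_map π)
    (Abelian.Ext.subsingleton_of_projective (Projective.over C) M 0) fun f => ?_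
  exact exists_extension_of_reitenRingelCondition h hU hRR hM
    (h.torsionFree_of_injective hC (π.quotKerEquivOfSurjective hπ).toLinearMap
      (LinearEquiv.injective _)) f

/-- `U` itself lies in `rightPerp 𝒴`, so the double orthogonal class is no larger than `𝒴`. -/
theorem isCotorsionPair_rightPerp (hU : ∀ M, 𝒴 M ↔ Subsingleton (Abelian.Ext M U 1)) :
    IsCotorsionPair 𝒴 (rightPerp 𝒴) :=
  ⟨le_antisymm (fun M hM _ hC => hC M hM)
    fun M hM => (hU M).2 (hM U fun C hC => (hU C).1 hC), rfl⟩

end ReitenRingel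

end CotiltingTheory

theorem mainTheorem9 {R : Type u} [Ring R]
    (𝒳 𝒴 : ObjectProperty (ModuleCat.{u} Rᵐᵒᵖ))
    (hcot : CotiltingTheory.IsCotiltingTorsionPair 𝒳 𝒴)
    (hRR : CotiltingTheory.ReitenRingelCondition 𝒳 𝒴) :
    CotiltingTheory.rightPerp 𝒴 =
        CotiltingTheory.rightPerp (CotiltingTheory.finitelyGeneratedPart 𝒴) ∧
      CotiltingTheory.IsCotorsionPair 𝒴 (CotiltingTheory.rightPerp 𝒴) ∧
      (𝒴, CotiltingTheory.rightPerp 𝒴) =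
        CotiltingTheory.cotorsionPairGeneratedBy
          (CotiltingTheory.finitelyGeneratedPart 𝒴) := by
  obtain ⟨h, U, hcotU, hY⟩ := hcot
  have hU : ∀ M, 𝒴 M ↔ Subsingleton (Abelian.Ext M U 1) := fun M => by
    rw [hY, CotiltingTheory.leftPerpInf_iff hcotU.injectiveDimension_le_one]
  have hperp := CotiltingTheory.rightPerp_finitelyGeneratedPart h hU hRR
  have hpair := CotiltingTheory.isCotorsionPair_rightPerp hU
  refine ⟨hperp, hpair, ?_⟩
  rw [CotiltingTheory.cotorsionPairGeneratedBy, ← hperp, ← hpair.1]
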